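/- For a function $f\colon[-1,1)\to\mathbb{R}$ and a finite subset $C$ of the unit sphere $S^3\subset\mathbb{R}^4$, let $$E_f(C)=\sum_{c,c'\in C,\ c\ne c'} f\bigl(\langle c,c'\rangle\bigr),$$ the sum being over ordered pairs of distinct points. Let $C_{D_4}\subset S^3$ be the normalized $D_4$ root system, that is, the $24$ vectors $(\pm e_i\pm e_j)/\sqrt2$ with $1\le i<j\le4$, where $e_1,\dots,e_4$ is the standard basis of $\mathbb{R}^4$. Identify $\mathbb{R}^4$ with $\mathbb{C}^2$, and for $\theta\in\mathbb{R}$ with $\sin2\theta\ne0$ and $\sin\theta\ne\cos\theta$ let $C_\theta\subset S^3$ be the $24$-point set $$C_\theta=\{(z,0),\ (0,w),\ (z\sin\theta,w\cos\theta),\ (z\cos\theta,w\sin\theta) : z,w\in\mathbb{C},\ z^3=w^3=1\}.$$ **Proposition.** Let $k$ be a nonnegative integer and $f(t)=(1+t)^k$ (so $f\equiv1$ if $k=0$). There is a $\theta\in\mathbb{R}$ with $\sin2\theta\ne0$ and $\sin\theta\ne\cos\theta$ such that $E_f(C_\theta)<E_f(C_{D_4})$ if and only if $8\le k\le13$. For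 every other nonnegative integer $k$, $E_f(C_\theta)\ge E_f(C_{D_4})$ for all such $\theta$. -/

import Mathlib

/-- The usual identification of `ℂ²` with Euclidean `ℝ⁴`. -/
noncomputable def toR4 (w₁ w₂ : ℂ) : EuclideanSpace ℝ (Fin 4) :=
  !₂[w₁.re, w₁.im, w₂.re, w₂.im]

/-- The `f`-energy of a finite set `C`: the sum of `f ⟨c, c'⟩` over all ordered pairs of distinct
points `c`, `c'` of `C`. -/
noncomputable def energy (f : ℝ → ℝ) (C : Finset (EuclideanSpace ℝ (Fin 4))) : ℝ :=
  ∑ c ∈ C, ∑ c' ∈ C with c' ≠ c, f (inner ℝ c c')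

/-- The parameters for which the code `codeTheta θ` is considered. -/
def Admissible (θ : ℝ) : Prop :=
  Real.sin (2 * θ) ≠ 0 ∧ Real.sin θ ≠ Real.cos θ

open Classical in
/-- The code consisting of all points `(z, 0)`, `(0, w)`, `(z sin θ, w cos θ)` and
`(z cos θ, w sin θ)` of `ℂ² = ℝ⁴` with `z ^ 3 = w ^ 3 = 1`. -/
noncomputable def codeTheta (θ : ℝ) : Finset (EuclideanSpace ℝ (Fin 4)) :=
  let μ : Finset ℂ := Polynomial.nthRootsFinset 3 (1 : ℂ)
  μ.image (fun z => toR4 z 0) ∪ μ.image (fun w => toR4 0 w) ∪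
    (μ ×ˢ μ).image (fun p => toR4 (p.1 * (Real.sin θ : ℂ)) (p.2 * (Real.cos θ : ℂ))) ∪
    (μ ×ˢ μ).image (fun p => toR4 (p.1 * (Real.cos θ : ℂ)) (p.2 * (Real.sin θ : ℂ)))

/-- The points of `codeTheta θ`, in set-builder form. -/
theorem mem_codeTheta (θ : ℝ) (x : EuclideanSpace ℝ (Fin 4)) :
    x ∈ codeTheta θ ↔ ∃ z w : ℂ, z ^ 3 = 1 ∧ w ^ 3 = 1 ∧
      (x = toR4 z 0 ∨ x = toR4 0 w ∨
        x = toR4 (z * (Real.sin θ : ℂ)) (w * (Real.cos θ : ℂ)) ∨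
        x = toR4 (z * (Real.cos θ : ℂ)) (w * (Real.sin θ : ℂ))) := by
  simp only [codeTheta, Finset.mem_union, Finset.mem_image, Finset.mem_product, Prod.exists,
    Polynomial.mem_nthRootsFinset (by norm_num : 0 < 3)]
  constructor
  · rintro (((⟨z, hz, rfl⟩ | ⟨w, hw, rfl⟩) | ⟨z, w, ⟨hz, hw⟩, rfl⟩) | ⟨z, w, ⟨hz, hw⟩, rfl⟩)
    · exact ⟨z, 1, hz, one_pow 3, Or.inl rfl⟩
    · exact ⟨1, w, one_pow 3, hw, Or.inr (Or.inl rfl)⟩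
    · exact ⟨z, w, hz, hw, Or.inr (Or.inr (Or.inl rfl))⟩
    · exact ⟨z, w, hz, hw, Or.inr (Or.inr (Or.inr rfl))⟩
  · rintro ⟨z, w, hz, hw, rfl | rfl | rfl | rfl⟩
    · exact Or.inl (Or.inl (Or.inl ⟨z, hz, rfl⟩))
    · exact Or.inl (Or.inl (Or.inr ⟨w, hw, rfl⟩))
    · exact Or.inl (Or.inr ⟨z, w, ⟨hz, hw⟩, rfl⟩)
    · exact Or.inr ⟨z, w, ⟨hz, hw⟩, rfl⟩

open Classical in
/-- The `D₄` root system, rescaled to the unit sphere: the `24` vectors `(± eᵢ ± eⱼ) / √2` with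
`i < j`, where `e₀, …, e₃` is the standard basis of `ℝ⁴`. -/
noncomputable def codeD4 : Finset (EuclideanSpace ℝ (Fin 4)) :=
  (((Finset.univ : Finset (Fin 4 × Fin 4)).filter (fun p => p.1 < p.2)) ×ˢ
      (({1, -1} : Finset ℝ) ×ˢ ({1, -1} : Finset ℝ))).image
    (fun q => (Real.sqrt 2)⁻¹ •
      (q.2.1 • EuclideanSpace.single q.1.1 (1 : ℝ) + q.2.2 • EuclideanSpace.single q.1.2 (1 : ℝ)))

/-!
The energies are computed exactly. The inner products of distinct vectors of the root system are
`-1`, `-1/2`, `0`, `1/2`, taken `24`, `192`, `144`, `192` times (`energy_codeD4`). The points of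
`codeTheta θ` lie on tori `(a z, b w)` with `z`, `w` cube roots of unity, and a double sum over two
such tori depends only on the real parts `1` and `-1/2` of products of cube roots of unity
(`torusSum_torusSum`); this gives `energy_codeTheta`. The result is symmetric in `s = sin θ` and
`c = cos θ`, so for `f(t) = (1 + t) ^ k` it is a polynomial in `p = s + c`, because
`s c = (p ^ 2 - 1) / 2`. After multiplication by `4 ^ k` the coefficients are integers. They are
computed as lists, by Newton's recursion for power sums (`thetaL`, `evalL_thetaL`).

* For `k ≤ 7` and for `k = 14` the difference of the two energies is nonnegative for
  `|p| ≤ √2`. It vanishes for `k ≤ 2`, is a multiple of the square of a cubic for `k = 3`, and in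
  the other cases has nonnegative Bernstein coefficients on each piece of a subdivision into at most
  three intervals (`evalL_diffL_nonneg`).
* For `k ≥ 14`, put `y = 1 + t`. Since `y ^ m (y - 3/2) ≥ (3/2) ^ m (y - 3/2)` for every `y ≥ 0`, the
  inequality `E (k + 1) ≥ (3/2) E k` for the energies of `codeTheta θ` follows for all `k ≥ 14` from
  the case `k = 14`, which is again a polynomial inequality in `p` (`evalL_thetaL_growth`,
  `thetaSum_growth`). The largest inner product in the root system being `1/2`, its energy grows at
  most by the factor `3/2` (`d4Z_succ_le`). So the comparison for `k = 14` propagates upwards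
  (`d4Z_le_thetaL`).
* For `8 ≤ k ≤ 13` the difference is negative at `p = -1/4` (`evalL_diffL_neg`).
-/

/-! ### Integer polynomials as coefficient lists -/

/-- The value at `x` of the polynomial whose coefficients, constant term first, are the entries of
the list. -/
def evalL : List ℤ → ℝ → ℝ
  | [], _ => 0
  | a :: l, x => a + x * evalL l x

/-- Addition of coefficient lists. -/
def addL : List ℤ → List ℤ → List ℤ
  | [], m => m
  | a :: l, [] => a :: l
  | a :: l, b :: m => (a + b) :: addL l m

/-- Multiplication of a coefficient list by a constant. -/
def smulL (a : ℤ) : List ℤ → List ℤ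
  | [] => []
  | b :: l => (a * b) :: smulL a l

/-- Multiplication of coefficient lists. -/
def mulL : List ℤ → List ℤ → List ℤ
  | [], _ => []
  | a :: l, m => addL (smulL a m) (0 :: mulL l m)

/-- Powers of a coefficient list. -/
def powL (l : List ℤ) : ℕ → List ℤ
  | 0 => [1]
  | k + 1 => mulL l (powL l k)

/-- The power sums `a ^ k + b ^ k` and `a ^ (k + 1) + b ^ (k + 1)` as polynomials in the elementary
symmetric functions `e₁ = a + b` and `e₂ = a * b`, by Newton's recursion. -/
def psumPairL (e₁ e₂ : List ℤ) : ℕ → List ℤ × List ℤ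
  | 0 => ([2], e₁)
  | k + 1 =>
    ((psumPairL e₁ e₂ k).2,
      addL (mulL e₁ (psumPairL e₁ e₂ k).2) (smulL (-1) (mulL e₂ (psumPairL e₁ e₂ k).1)))

/-- The power sum `a ^ k + b ^ k` as a polynomial in `e₁ = a + b` and `e₂ = a * b`. -/
def psumL (e₁ e₂ : List ℤ) (k : ℕ) : List ℤ := (psumPairL e₁ e₂ k).1

theorem evalL_addL (l m : List ℤ) (x : ℝ) : evalL (addL l m) x = evalL l x + evalL m x := by
  induction l generalizing m with
  | nil => simp [addL, evalL]
  | cons a l ih =>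
    cases m with
    | nil => simp [addL, evalL]
    | cons b m => simp only [addL, evalL, ih]; push_cast; ring

theorem evalL_smulL (a : ℤ) (l : List ℤ) (x : ℝ) : evalL (smulL a l) x = a * evalL l x := by
  induction l with
  | nil => simp [smulL, evalL]
  | cons b l ih => simp only [smulL, evalL, ih]; push_cast; ring

theorem evalL_mulL (l m : List ℤ) (x : ℝ) : evalL (mulL l m) x = evalL l x * evalL m x := by
  induction l with
  | nil => simp [mulL, evalL]
  | cons a l ih => simp only [mulL, evalL, evalL_addL, evalL_smulL, ih]; push_cast; ring

theorem evalL_powL (l : List ℤ) (k : ℕ) (x : ℝ) : evalL (powL l k) x = evalL l x ^ k := by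
  induction k with
  | zero => simp [powL, evalL]
  | succ k ih => rw [powL, evalL_mulL, ih, pow_succ']

theorem evalL_psumPairL {e₁ e₂ : List ℤ} {x a b : ℝ} (h₁ : evalL e₁ x = a + b)
    (h₂ : evalL e₂ x = a * b) (k : ℕ) :
    evalL (psumPairL e₁ e₂ k).1 x = a ^ k + b ^ k ∧
      evalL (psumPairL e₁ e₂ k).2 x = a ^ (k + 1) + b ^ (k + 1) := by
  induction k with
  | zero => simp [psumPairL, evalL, h₁]; norm_num
  | succ k ih =>
    refine ⟨ih.2, ?_⟩
    simp only [psumPairL, evalL_addL, evalL_mulL, evalL_smulL, ih.1, ih.2, h₁, h₂]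
    push_cast
    ring

theorem evalL_psumL {e₁ e₂ : List ℤ} {x a b : ℝ} (h₁ : evalL e₁ x = a + b)
    (h₂ : evalL e₂ x = a * b) (k : ℕ) : evalL (psumL e₁ e₂ k) x = a ^ k + b ^ k :=
  (evalL_psumPairL h₁ h₂ k).1

theorem evalL_nonneg {l : List ℤ} (h : ∀ a ∈ l, 0 ≤ a) {x : ℝ} (hx : 0 ≤ x) : 0 ≤ evalL l x := by
  induction l with
  | nil => simp [evalL]
  | cons a l ih =>
    have ha : (0 : ℝ) ≤ a := by exact_mod_cast h a (by simp)
    have := ih fun b hb => h b (by simp [hb])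
    simp only [evalL]
    positivity

/-! ### Positivity on an interval through Bernstein coefficients -/

/-- Homogenised substitution: for a list `l` of length `n`, the polynomials
`∑ lᵢ Uⁱ Wⁿ⁻¹⁻ⁱ` and `Wⁿ`. -/
def homL (U W : List ℤ) : List ℤ → List ℤ × List ℤ
  | [] => ([], [1])
  | a :: l => (addL (smulL a (homL U W l).2) (mulL U (homL U W l).1), mulL W (homL U W l).2)

theorem evalL_homL {U W : List ℤ} {v x : ℝ} (h : evalL U v = x * evalL W v) (l : List ℤ) :
    evalL (homL U W l).2 v = evalL W v ^ l.length ∧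
      evalL (homL U W l).1 v * evalL W v = evalL W v ^ l.length * evalL l x := by
  induction l with
  | nil => simp [homL, evalL]
  | cons a l ih =>
    obtain ⟨h₁, h₂⟩ := ih
    refine ⟨?_, ?_⟩
    · rw [homL, evalL_mulL, h₁, List.length_cons, pow_succ']
    · simp only [homL, evalL_addL, evalL_smulL, evalL_mulL, h, h₁, evalL, List.length_cons]
      rw [add_mul, mul_assoc (x * evalL W v), h₂]
      ring

/-- With `n + 1` the length of `l`: the coefficients of `(100 (1 + v))ⁿ l(x)`, where
`x = (a + b v) / (100 (1 + v))`, are all nonnegative. They are positive multiples of the Bernstein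
coefficients of `l` on the interval from `a / 100` to `b / 100`. -/
def BernsteinNonneg (l : List ℤ) (a b : ℤ) : Prop :=
  ∀ c ∈ (homL [a, b] [100, 100] l).1, 0 ≤ c

instance (l : List ℤ) (a b : ℤ) : Decidable (BernsteinNonneg l a b) :=
  inferInstanceAs (Decidable (∀ c ∈ (homL [a, b] [100, 100] l).1, 0 ≤ c))

theorem BernsteinNonneg.evalL_nonneg {l : List ℤ} {a b : ℤ} (h : BernsteinNonneg l a b) {x : ℝ}
    (ha : a ≤ 100 * x) (hb : 100 * x < b) : 0 ≤ evalL l x := by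
  -- `v` is the coordinate that carries `[a / 100, b / 100)` to `[0, ∞)`
  obtain ⟨v, hv, hvx⟩ : ∃ v : ℝ, 0 ≤ v ∧ a + b * v = x * (100 * (1 + v)) := by
    have hpos : 0 < b - 100 * x := by linarith
    refine ⟨(100 * x - a) / (b - 100 * x), div_nonneg (by linarith) hpos.le, ?_⟩
    field_simp
    ring
  have hW : evalL [100, 100] v = 100 * (1 + v) := by simp [evalL]; ring
  have hU : evalL [a, b] v = x * evalL [100, 100] v := by
    rw [hW, ← hvx]; simp [evalL]; ring
  have hWpos : 0 < evalL [100, 100] v := by rw [hW]; positivity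
  have hmain := (evalL_homL hU l).2
  have hnn : 0 ≤ evalL [100, 100] v ^ l.length * evalL l x := by
    rw [← hmain]
    exact mul_nonneg (_root_.evalL_nonneg h hv) hWpos.le
  exact nonneg_of_mul_nonneg_right hnn (by positivity)

/-- Gluing the Bernstein criterion over consecutive intervals with endpoints in `ℤ / 100`. -/
theorem evalL_nonneg_of_isChain {l : List ℤ} {a : ℤ} {L : List ℤ}
    (h : (a :: L).IsChain (BernsteinNonneg l)) {x : ℝ} (ha : a ≤ 100 * x)
    (hb : 100 * x < (a :: L).getLast (by simp)) : 0 ≤ evalL l x := by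
  induction L generalizing a with
  | nil => simp at hb; linarith
  | cons b L ih =>
    rw [List.isChain_cons_cons] at h
    rcases lt_or_ge (100 * x) b with hx | hx
    · exact h.1.evalL_nonneg ha hx
    · exact ih h.2 hx (by simpa using hb)

/-! ### The two energies as integer polynomials -/

/-- `4 ^ k` times the energy of `codeTheta θ` for the potential `(1 + t) ^ k`, as a polynomial in
`p = sin θ + cos θ`. The pairs of inner products exchanged by `sin ↔ cos` enter through power sums,
and `sin θ * cos θ = (p ^ 2 - 1) / 2`. The three pairs of lists are the sum and the product of
`4 (1 + t)` over such a pair of inner products `t`, the last three lists are single values of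
`4 (1 + t)`. -/
def thetaL (k : ℕ) : List ℤ :=
  addL [84 * 2 ^ k + 18 * 4 ^ k] <|
  addL (smulL 36 (psumL [8, 4] [8, 16, 8] k)) <|
  addL (smulL 72 (psumL [8, -2] [14, -8, 2] k)) <|
  addL (smulL 36 (psumL [10] [25, 0, -18, 0, 9] k)) <|
  addL (smulL 18 (powL [0, 0, 4] k)) <|
  addL (smulL 72 (powL [3, 0, 1] k)) (smulL 72 (powL [6, 0, -2] k))

/-- `4 ^ k` times the energy of `codeD4` for the potential `(1 + t) ^ k`. -/
def d4Z (k : ℕ) : ℤ := 24 * (0 ^ k + 8 * 2 ^ k + 6 * 4 ^ k + 8 * 6 ^ k)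

/-- `4 ^ k` times the difference of the energies of `codeTheta θ` and `codeD4`, as a polynomial
in `sin θ + cos θ`. -/
def diffL (k : ℕ) : List ℤ := addL (thetaL k) [-d4Z k]

/-- The energy of `codeTheta θ` for the potential `g`, with `s = sin θ` and `c = cos θ`: the sum of
`g` over the inner products of distinct points, with their multiplicities. -/
noncomputable def thetaSum (g : ℝ → ℝ) (s c : ℝ) : ℝ :=
  84 * g (-1 / 2) + 18 * g 0 + 36 * (g s + g c) + 72 * (g (-s / 2) + g (-c / 2)) +
    36 * (g (s ^ 2 - c ^ 2 / 2) + g (c ^ 2 - s ^ 2 / 2)) + 18 * g (2 * (s * c)) +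
    72 * g (s * c / 2) + 72 * g (-(s * c))

theorem evalL_thetaL {s c : ℝ} (h : s ^ 2 + c ^ 2 = 1) (k : ℕ) :
    evalL (thetaL k) (s + c) = 4 ^ k * thetaSum (fun t => (1 + t) ^ k) s c := by
  have hq : s * c = ((s + c) ^ 2 - 1) / 2 := by linear_combination -h / 2
  have e₁ := evalL_psumL (e₁ := [8, 4]) (e₂ := [8, 16, 8]) (x := s + c) (a := 4 * (1 + s))
    (b := 4 * (1 + c)) (by simp [evalL]; ring)
    (by simp [evalL]; linear_combination 8 * h) k
  have e₂ := evalL_psumL (e₁ := [8, -2]) (e₂ := [14, -8, 2]) (x := s + c) (a := 4 * (1 + -s / 2))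
    (b := 4 * (1 + -c / 2)) (by simp [evalL]; ring)
    (by simp [evalL]; linear_combination 2 * h) k
  have e₃ := evalL_psumL (e₁ := [10]) (e₂ := [25, 0, -18, 0, 9]) (x := s + c)
    (a := 4 * (1 + (s ^ 2 - c ^ 2 / 2))) (b := 4 * (1 + (c ^ 2 - s ^ 2 / 2)))
    (by simp [evalL]; linear_combination -2 * h)
    (by
      have hx : evalL [25, 0, -18, 0, 9] (s + c) = 16 + 9 * ((s + c) ^ 2 - 1) ^ 2 := by
        simp [evalL]; ring
      have hs : (s + c) ^ 2 - 1 = 2 * (s * c) := by linear_combination h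
      rw [hx, hs]
      linear_combination 8 * (s ^ 2 + c ^ 2) * h) k
  have e₄ : evalL [0, 0, 4] (s + c) = 4 * (1 + 2 * (s * c)) := by
    rw [hq]; simp [evalL]; ring
  have e₅ : evalL [3, 0, 1] (s + c) = 4 * (1 + s * c / 2) := by
    rw [hq]; simp [evalL]; ring
  have e₆ : evalL [6, 0, -2] (s + c) = 4 * (1 + -(s * c)) := by
    rw [hq]; simp [evalL]; ring
  have e₀ : (2 : ℝ) ^ k = 4 ^ k * (1 + -1 / 2) ^ k := by rw [← mul_pow]; norm_num
  simp only [thetaL, evalL_addL, evalL_smulL, evalL_powL, e₁, e₂, e₃, e₄, e₅, e₆, mul_pow]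
  simp only [thetaSum, evalL]
  push_cast
  rw [e₀]
  ring

/-! ### Small exponents, and the transition at exponent fourteen -/

theorem diffL_three : diffL 3 = smulL 72 (powL [2, 9, 0, -3] 2) := by decide +kernel

/-- Every `θ` has `|sin θ + cos θ| ≤ √2 < 1.42`, so this compares the energies for all `θ`. -/
theorem evalL_diffL_nonneg {k : ℕ} (hk : k ≤ 7 ∨ k = 14) {x : ℝ} (hx : |x| < 1.42) :
    0 ≤ evalL (diffL k) x := by
  obtain ⟨h₁, h₂⟩ := abs_lt.1 hx
  have key : ∀ L : List ℤ, ((-142) :: L).IsChain (BernsteinNonneg (diffL k)) →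
      ((-142) :: L).getLast (by simp) = 142 → 0 ≤ evalL (diffL k) x := fun L hL hlast =>
    evalL_nonneg_of_isChain hL (by push_cast; linarith) (by rw [hlast]; push_cast; linarith)
  have hcases : k = 0 ∨ k = 1 ∨ k = 2 ∨ k = 3 ∨ k = 4 ∨ k = 5 ∨ k = 6 ∨ k = 7 ∨ k = 14 := by omega
  rcases hcases with rfl | rfl | rfl | rfl | rfl | rfl | rfl | rfl | rfl
  · exact key [142] (by decide +kernel) rfl
  · exact key [142] (by decide +kernel) rfl
  · exact key [142] (by decide +kernel) rfl
  · -- the double zero is irrational, so no subdivision at rational points would do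
    rw [diffL_three, evalL_smulL, evalL_powL]
    positivity
  · exact key [-23, -20, 142] (by decide +kernel) rfl
  · exact key [-23, 142] (by decide +kernel) rfl
  · exact key [-24, 40, 142] (by decide +kernel) rfl
  · exact key [-27, -12, 142] (by decide +kernel) rfl
  · exact key [-27, -23, 142] (by decide +kernel) rfl

/-- From exponent `14` to `15` the energy of `codeTheta θ`, scaled by `4 ^ k`, grows at least by the
factor `6`, which is the asymptotic growth rate of the energy of `codeD4`. -/
theorem evalL_thetaL_growth {x : ℝ} (hx : |x| < 1.42) :
    6 * evalL (thetaL 14) x ≤ evalL (thetaL 15) x := by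
  obtain ⟨h₁, h₂⟩ := abs_lt.1 hx
  have h : [-142, -44, -16, 142].IsChain
      (BernsteinNonneg (addL (thetaL 15) (smulL (-6) (thetaL 14)))) := by decide +kernel
  have := evalL_nonneg_of_isChain h (x := x) (by push_cast; linarith)
    (by simp only [List.getLast]; push_cast; linarith)
  rw [evalL_addL, evalL_smulL] at this
  push_cast at this
  linarith

/-- One value of `sin θ + cos θ`, close to the minimum of each of the six energies, works for all
exponents from `8` to `13`. -/
theorem evalL_diffL_neg {k : ℕ} (h₁ : 8 ≤ k) (h₂ : k ≤ 13) : evalL (diffL k) (-1 / 4) < 0 := by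
  -- with `U = -1` and `W = 4` the homogenised substitution is the numerator of the value at `-1/4`
  have h := (evalL_homL (U := [-1]) (W := [4]) (v := 0) (x := -1 / 4) (by simp [evalL])
    (diffL k)).2
  have hneg : evalL (homL [-1] [4] (diffL k)).1 0 < 0 := by
    have hhead : ∀ l : List ℤ, l.headD 0 < 0 → evalL l 0 < 0 := by
      rintro (_ | ⟨a, l⟩) hl
      · simp at hl
      · simpa [evalL] using hl
    apply hhead
    interval_cases k <;> decide +kernel
  have hW : evalL [4] 0 = 4 := by simp [evalL]
  rw [hW] at h
  by_contra! hcon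
  have : 0 ≤ (4 : ℝ) ^ (diffL k).length * evalL (diffL k) (-1 / 4) := by positivity
  linarith

/-! ### Large exponents -/

/-- All inner products that enter `thetaSum` are at least `-1`. -/
theorem thetaSum_mono {g g' : ℝ → ℝ} (hg : ∀ t, -1 ≤ t → g t ≤ g' t) {s c : ℝ}
    (h : s ^ 2 + c ^ 2 = 1) : thetaSum g s c ≤ thetaSum g' s c := by
  have hs : s ^ 2 ≤ 1 := by nlinarith [sq_nonneg c]
  have hc : c ^ 2 ≤ 1 := by nlinarith [sq_nonneg s]
  have hs' := abs_le.1 ((sq_le_one_iff_abs_le_one s).1 hs)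
  have hc' := abs_le.1 ((sq_le_one_iff_abs_le_one c).1 hc)
  have h₁ : -1 ≤ 2 * (s * c) := by nlinarith [sq_nonneg (s + c)]
  have h₂ : 2 * (s * c) ≤ 1 := by nlinarith [sq_nonneg (s - c)]
  have := hg (-1 / 2) (by norm_num)
  have := hg 0 (by norm_num)
  have := hg s (by linarith)
  have := hg c (by linarith)
  have := hg (-s / 2) (by linarith)
  have := hg (-c / 2) (by linarith)
  have := hg (s ^ 2 - c ^ 2 / 2) (by linarith [sq_nonneg s])
  have := hg (c ^ 2 - s ^ 2 / 2) (by linarith [sq_nonneg c])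
  have := hg (2 * (s * c)) h₁
  have := hg (s * c / 2) (by linarith)
  have := hg (-(s * c)) (by linarith)
  unfold thetaSum
  gcongr

theorem thetaSum_sub_mul (g g' : ℝ → ℝ) (r s c : ℝ) :
    thetaSum (fun t => g t - r * g' t) s c = thetaSum g s c - r * thetaSum g' s c := by
  unfold thetaSum
  ring

theorem thetaSum_mul (g : ℝ → ℝ) (r s c : ℝ) :
    thetaSum (fun t => r * g t) s c = r * thetaSum g s c := by
  unfold thetaSum
  ring

/-- The growth by the factor `6` (after scaling by `4 ^ k`) propagates from exponent `14` to all
larger exponents. -/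
theorem thetaSum_growth {s c : ℝ} (h : s ^ 2 + c ^ 2 = 1)
    (h14 : 6 * (4 ^ 14 * thetaSum (fun t => (1 + t) ^ 14) s c) ≤
      4 ^ 15 * thetaSum (fun t => (1 + t) ^ 15) s c) {k : ℕ} (hk : 14 ≤ k) :
    6 * (4 ^ k * thetaSum (fun t => (1 + t) ^ k) s c) ≤
      4 ^ (k + 1) * thetaSum (fun t => (1 + t) ^ (k + 1)) s c := by
  obtain ⟨m, rfl⟩ := Nat.exists_eq_add_of_le hk
  -- each summand satisfies `y ^ m * (y - r) ≥ r ^ m * (y - r)` with `r = 3 / 2`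
  have key : ∀ t : ℝ, -1 ≤ t → (3 / 2) ^ m * ((1 + t) ^ 15 - 3 / 2 * (1 + t) ^ 14) ≤
      (1 + t) ^ (14 + m + 1) - 3 / 2 * (1 + t) ^ (14 + m) := by
    intro t ht
    obtain ⟨y, hyt⟩ : ∃ y, y = 1 + t := ⟨_, rfl⟩
    rw [← hyt]
    have hy : 0 ≤ y := by linarith
    have : 0 ≤ (y ^ m - (3 / 2) ^ m) * (y - 3 / 2) := by
      rcases le_total (3 / 2) y with h' | h'
      · exact mul_nonneg (sub_nonneg.2 (by gcongr)) (by linarith)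
      · exact mul_nonneg_of_nonpos_of_nonpos (sub_nonpos.2 (by gcongr)) (by linarith)
    have := mul_nonneg (pow_nonneg hy 14) this
    have e : y ^ (14 + m + 1) - 3 / 2 * y ^ (14 + m) -
        (3 / 2) ^ m * (y ^ 15 - 3 / 2 * y ^ 14) =
        y ^ 14 * ((y ^ m - (3 / 2) ^ m) * (y - 3 / 2)) := by ring
    exact sub_nonneg.1 (e ▸ this)
  have h₁ := thetaSum_mono key h
  rw [thetaSum_mul, thetaSum_sub_mul, thetaSum_sub_mul] at h₁
  have h₂ : 0 ≤ thetaSum (fun t => (1 + t) ^ 15) s c -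
      3 / 2 * thetaSum (fun t => (1 + t) ^ 14) s c := by
    generalize thetaSum (fun t => (1 + t) ^ 15) s c = a at *
    generalize thetaSum (fun t => (1 + t) ^ 14) s c = b at *
    linarith
  have h₃ := (mul_nonneg (by positivity : (0 : ℝ) ≤ (3 / 2) ^ m) h₂).trans h₁
  have := mul_nonneg (by positivity : (0 : ℝ) ≤ 4 ^ (14 + m + 1)) h₃
  generalize thetaSum (fun t => (1 + t) ^ (14 + m + 1)) s c = a at *
  generalize thetaSum (fun t => (1 + t) ^ (14 + m)) s c = b at *
  rw [pow_succ] at this ⊢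
  linarith

theorem d4Z_succ_le {k : ℕ} : d4Z (k + 1) ≤ 6 * d4Z k := by
  have h : ∀ n : ℤ, 0 ≤ n → n ≤ 6 → n ^ (k + 1) ≤ 6 * n ^ k := fun n h0 h6 => by
    rw [pow_succ']; gcongr
  have := h 0 (by norm_num) (by norm_num)
  have := h 2 (by norm_num) (by norm_num)
  have := h 4 (by norm_num) (by norm_num)
  have := h 6 (by norm_num) (by norm_num)
  unfold d4Z
  linarith

theorem d4Z_le_thetaL {s c : ℝ} (h : s ^ 2 + c ^ 2 = 1) {k : ℕ} (hk : ¬(8 ≤ k ∧ k ≤ 13)) :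
    d4Z k ≤ evalL (thetaL k) (s + c) := by
  have hx : |s + c| < 1.42 := abs_lt_of_sq_lt_sq (by nlinarith [sq_nonneg (s - c)]) (by norm_num)
  have base : ∀ {k : ℕ}, k ≤ 7 ∨ k = 14 → d4Z k ≤ evalL (thetaL k) (s + c) := fun hk => by
    have := evalL_diffL_nonneg hk hx
    simp only [diffL, evalL_addL, evalL] at this
    push_cast at this
    linarith
  rcases le_or_gt 14 k with hk14 | hk14
  · induction k, hk14 using Nat.le_induction with
    | base => exact base (Or.inr rfl)
    | succ k hk14 ih =>
      have h₁ := evalL_thetaL_growth hx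
      rw [evalL_thetaL h, evalL_thetaL h] at h₁
      have h₂ := thetaSum_growth h h₁ hk14
      rw [← evalL_thetaL h, ← evalL_thetaL h] at h₂
      have h₃ : (d4Z (k + 1) : ℝ) ≤ 6 * d4Z k := by exact_mod_cast d4Z_succ_le
      have := ih (by omega)
      linarith
  · exact base (by omega)

/-! ### The energy of the root system -/

/-- The integer vectors `± eᵢ ± eⱼ`, indexed as in `codeD4`. -/
def rootZ (q : (Fin 4 × Fin 4) × (ℤ × ℤ)) : Fin 4 → ℤ :=
  fun i => q.2.1 * (if i = q.1.1 then 1 else 0) + q.2.2 * (if i = q.1.2 then 1 else 0)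

/-- The `24` roots `± eᵢ ± eⱼ` of `D₄`, as integer vectors. -/
def rootsZ : Finset (Fin 4 → ℤ) :=
  (((Finset.univ : Finset (Fin 4 × Fin 4)).filter (fun p => p.1 < p.2)) ×ˢ
      (({1, -1} : Finset ℤ) ×ˢ ({1, -1} : Finset ℤ))).image rootZ

/-- The embedding of `ℤ⁴` into `ℝ⁴` rescaled by `1 / √2`. -/
noncomputable def scaleEmb (v : Fin 4 → ℤ) : EuclideanSpace ℝ (Fin 4) :=
  (Real.sqrt 2)⁻¹ • WithLp.toLp 2 (fun i => (v i : ℝ))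

theorem scaleEmb_injective : Function.Injective scaleEmb := by
  intro v w h
  have h2 : (Real.sqrt 2)⁻¹ ≠ 0 := by positivity
  have := smul_right_injective _ h2 h
  funext i
  have := congrArg (fun x : EuclideanSpace ℝ (Fin 4) => x i) this
  simpa using this

theorem inner_scaleEmb (v w : Fin 4 → ℤ) :
    inner ℝ (scaleEmb v) (scaleEmb w) = ((∑ i, v i * w i : ℤ) : ℝ) / 2 := by
  have h2 : (Real.sqrt 2)⁻¹ * (Real.sqrt 2)⁻¹ = 1 / 2 := by
    rw [← mul_inv, Real.mul_self_sqrt (by norm_num)]; norm_num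
  rw [scaleEmb, scaleEmb, real_inner_smul_left, real_inner_smul_right, ← mul_assoc, h2]
  simp [PiLp.inner_apply, mul_comm]
  ring

open Classical in
theorem codeD4_eq : codeD4 = rootsZ.image scaleEmb := by
  rw [codeD4, rootsZ, Finset.image_image]
  have hsign : ({1, -1} : Finset ℝ) = ({1, -1} : Finset ℤ).image (Int.cast : ℤ → ℝ) := by simp
  ext x
  simp only [hsign, Finset.mem_image, Finset.mem_product, Function.comp]
  constructor
  · rintro ⟨⟨p, a, b⟩, ⟨hp, ⟨a, ha, rfl⟩, b, hb, rfl⟩, rfl⟩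
    refine ⟨⟨p, a, b⟩, ⟨hp, ha, hb⟩, ?_⟩
    ext i
    simp [scaleEmb, rootZ, mul_add]
  · rintro ⟨⟨p, a, b⟩, ⟨hp, ha, hb⟩, rfl⟩
    refine ⟨⟨p, a, b⟩, ⟨hp, ⟨a, ha, rfl⟩, b, hb, rfl⟩, ?_⟩
    ext i
    simp [scaleEmb, rootZ, mul_add]

theorem image_rootsZ_inner :
    ((rootsZ ×ˢ rootsZ).filter fun p => p.2 ≠ p.1).image (fun p => ∑ i, p.1 i * p.2 i) =
      {-2, -1, 0, 1} := by decide +kernel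

theorem card_rootsZ_inner :
    (((rootsZ ×ˢ rootsZ).filter fun p => p.2 ≠ p.1).filter
        fun p => ∑ i, p.1 i * p.2 i = -2).card = 24 ∧
    (((rootsZ ×ˢ rootsZ).filter fun p => p.2 ≠ p.1).filter
        fun p => ∑ i, p.1 i * p.2 i = -1).card = 192 ∧
    (((rootsZ ×ˢ rootsZ).filter fun p => p.2 ≠ p.1).filter
        fun p => ∑ i, p.1 i * p.2 i = 0).card = 144 ∧
    (((rootsZ ×ˢ rootsZ).filter fun p => p.2 ≠ p.1).filter
        fun p => ∑ i, p.1 i * p.2 i = 1).card = 192 := by decide +kernel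

theorem energy_codeD4 (f : ℝ → ℝ) :
    energy f codeD4 = 24 * f (-1) + 192 * f (-1 / 2) + 144 * f 0 + 192 * f (1 / 2) := by
  have h₁ : energy f codeD4 =
      ∑ p ∈ (rootsZ ×ˢ rootsZ).filter (fun p => p.2 ≠ p.1),
        f (((∑ i, p.1 i * p.2 i : ℤ) : ℝ) / 2) := by
    rw [energy, codeD4_eq, Finset.sum_image scaleEmb_injective.injOn, Finset.sum_filter,
      Finset.sum_product]
    refine Finset.sum_congr rfl fun v _ => ?_
    rw [Finset.sum_filter, Finset.sum_image scaleEmb_injective.injOn]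
    simp only [scaleEmb_injective.ne_iff, inner_scaleEmb]
  obtain ⟨c₁, c₂, c₃, c₄⟩ := card_rootsZ_inner
  refine h₁.trans ((Finset.sum_comp (fun n : ℤ => f ((n : ℝ) / 2))
    (fun p : (Fin 4 → ℤ) × (Fin 4 → ℤ) => ∑ i, p.1 i * p.2 i)).trans ?_)
  rw [image_rootsZ_inner]
  simp only [Finset.sum_insert (show (-2 : ℤ) ∉ ({-1, 0, 1} : Finset ℤ) by decide),
    Finset.sum_insert (show (-1 : ℤ) ∉ ({0, 1} : Finset ℤ) by decide),
    Finset.sum_insert (show (0 : ℤ) ∉ ({1} : Finset ℤ) by decide), Finset.sum_singleton,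
    c₁, c₂, c₃, c₄, nsmul_eq_mul]
  norm_num
  ring

theorem four_pow_mul_energy_codeD4 (k : ℕ) :
    4 ^ k * energy (fun t => (1 + t) ^ k) codeD4 = d4Z k := by
  rw [energy_codeD4]
  simp only [d4Z, mul_add, mul_left_comm ((4 : ℝ) ^ k), ← mul_pow]
  push_cast
  norm_num
  ring

/-! ### The energy of the codes with threefold symmetry -/

/-- The cube roots of unity. -/
noncomputable def mu3 : Finset ℂ := Polynomial.nthRootsFinset 3 (1 : ℂ)

theorem mem_mu3 {z : ℂ} : z ∈ mu3 ↔ z ^ 3 = 1 := by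
  simp [mu3, Polynomial.mem_nthRootsFinset (by norm_num : 0 < 3)]

/-- The primitive cube root of unity in the upper half plane. -/
noncomputable def omega : ℂ := ⟨-1 / 2, Real.sqrt 3 / 2⟩

theorem mu3_eq : mu3 = {1, omega, star omega} := by
  have h3 : Real.sqrt 3 ^ 2 = 3 := Real.sq_sqrt (by norm_num)
  have hadd : omega + star omega = -1 := by
    apply Complex.ext <;> norm_num [omega]
  have hmul : omega * star omega = 1 := by
    apply Complex.ext <;> simp [omega] <;> nlinarith
  ext z
  rw [mem_mu3, ← sub_eq_zero, show z ^ 3 - 1 = (z - 1) * ((z - omega) * (z - star omega)) by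
    linear_combination (z - 1) * z * hadd - (z - 1) * hmul]
  simp [sub_eq_zero]

theorem sum_mu3 (F : ℂ → ℝ) : ∑ z ∈ mu3, F z = F 1 + F omega + F (star omega) := by
  have h3 : 0 < Real.sqrt 3 := by positivity
  have h₁ : (1 : ℂ) ∉ ({omega, star omega} : Finset ℂ) := by
    simp only [Finset.mem_insert, Finset.mem_singleton, not_or]
    constructor <;> intro h <;> have := congrArg Complex.re h <;> norm_num [omega] at this
  have h₂ : omega ∉ ({star omega} : Finset ℂ) := by
    rw [Finset.mem_singleton]
    intro h
    have := congrArg Complex.im h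
    simp [omega] at this
    linarith
  rw [mu3_eq, Finset.sum_insert h₁, Finset.sum_insert h₂, Finset.sum_singleton, add_assoc]

/-- Among the nine products `z * star z'` of cube roots of unity, three are `1` and six have real
part `-1 / 2`. -/
theorem sum_mu3_re (F : ℝ → ℝ) :
    ∑ z ∈ mu3, ∑ z' ∈ mu3, F (z * star z').re = 3 * (F 1 + 2 * F (-1 / 2)) := by
  have h3 : Real.sqrt 3 * Real.sqrt 3 = 3 := Real.mul_self_sqrt (by norm_num)
  have e₁ : (omega * star omega).re = 1 := by
    simp [omega]; linarith
  have e₂ : (omega * omega).re = -1 / 2 := by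
    simp [omega]; linarith
  have e₃ : (star omega * star omega).re = -1 / 2 := by
    simp [omega]; linarith
  have e₄ : omega.re = -1 / 2 := rfl
  have e₅ : (star omega).re = -1 / 2 := rfl
  simp only [sum_mu3, star_one, mul_one, one_mul, star_star, mul_comm (star omega) omega, e₁, e₂,
    e₃, e₄, e₅, Complex.one_re]
  ring

theorem inner_toR4 (a b a' b' : ℝ) (z w z' w' : ℂ) :
    inner ℝ (toR4 (z * a) (w * b)) (toR4 (z' * a') (w' * b')) =
      a * a' * (z * star z').re + b * b' * (w * star w').re := by
  simp [toR4, PiLp.inner_apply, Fin.sum_univ_four]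
  ring

/-- The sum of `F` over the points `(a z, b w)` with `z` and `w` running through the cube roots
of unity; if `b = 0` or `a = 0`, then every point occurs three times. -/
noncomputable def torusSum (a b : ℝ) (F : EuclideanSpace ℝ (Fin 4) → ℝ) : ℝ :=
  ∑ z ∈ mu3, ∑ w ∈ mu3, F (toR4 (z * a) (w * b))

theorem torusSum_torusSum (f : ℝ → ℝ) (a b a' b' : ℝ) :
    torusSum a b (fun x => torusSum a' b' fun y => f (inner ℝ x y)) =
      9 * (f (a * a' + b * b') + 2 * f (a * a' - b * b' / 2) + 2 * f (b * b' - a * a' / 2) +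
        4 * f (-(a * a' + b * b') / 2)) := by
  simp only [torusSum, inner_toR4]
  have h : ∀ z ∈ mu3, (∑ w ∈ mu3, ∑ z' ∈ mu3, ∑ w' ∈ mu3,
      f (a * a' * (z * star z').re + b * b' * (w * star w').re)) =
      ∑ z' ∈ mu3, 3 * (f (a * a' * (z * star z').re + b * b' * 1) +
        2 * f (a * a' * (z * star z').re + b * b' * (-1 / 2))) := fun z _ => by
    rw [Finset.sum_comm]
    exact Finset.sum_congr rfl fun z' _ =>
      sum_mu3_re fun t => f (a * a' * (z * star z').re + b * b' * t)
  rw [Finset.sum_congr rfl h, sum_mu3_re fun t => 3 * (f (a * a' * t + b * b' * 1) +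
        2 * f (a * a' * t + b * b' * (-1 / 2)))]
  ring_nf

theorem toR4_inj {z w z' w' : ℂ} : toR4 z w = toR4 z' w' ↔ z = z' ∧ w = w' := by
  constructor
  · intro h
    have h0 := congrArg (fun x : EuclideanSpace ℝ (Fin 4) => x 0) h
    have h1 := congrArg (fun x : EuclideanSpace ℝ (Fin 4) => x 1) h
    have h2 := congrArg (fun x : EuclideanSpace ℝ (Fin 4) => x 2) h
    have h3 := congrArg (fun x : EuclideanSpace ℝ (Fin 4) => x 3) h
    simp [toR4] at h0 h1 h2 h3
    exact ⟨Complex.ext h0 h1, Complex.ext h2 h3⟩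
  · rintro ⟨rfl, rfl⟩
    rfl

theorem ne_zero_of_mem_mu3 {z : ℂ} (h : z ∈ mu3) : z ≠ 0 := by
  rintro rfl
  simp [mem_mu3] at h

theorem card_mu3 : (mu3.card : ℝ) = 3 := by
  have := sum_mu3 fun _ => 1
  simp at this
  rw [this]; norm_num

/-- For admissible `θ` the four families that make up `codeTheta θ` are disjoint and parametrized
injectively, up to the threefold repetition in the two degenerate tori. -/
theorem sum_codeTheta {θ : ℝ} (h : Admissible θ) (F : EuclideanSpace ℝ (Fin 4) → ℝ) :
    ∑ x ∈ codeTheta θ, F x =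
      torusSum 1 0 F / 3 + torusSum 0 1 F / 3 + torusSum (Real.sin θ) (Real.cos θ) F +
        torusSum (Real.cos θ) (Real.sin θ) F := by
  classical
  obtain ⟨h₁, h₂⟩ := h
  rw [Real.sin_two_mul] at h₁
  have hs : Real.sin θ ≠ 0 := fun h0 => h₁ (by rw [h0]; ring)
  have hc : Real.cos θ ≠ 0 := fun h0 => h₁ (by rw [h0]; ring)
  have hs' : (Real.sin θ : ℂ) ≠ 0 := Complex.ofReal_ne_zero.2 hs
  have hc' : (Real.cos θ : ℂ) ≠ 0 := Complex.ofReal_ne_zero.2 hc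
  have hcode : codeTheta θ = mu3.image (fun z => toR4 z 0) ∪ mu3.image (fun w => toR4 0 w) ∪
      (mu3 ×ˢ mu3).image
        (fun p => toR4 (p.1 * (Real.sin θ : ℂ)) (p.2 * (Real.cos θ : ℂ))) ∪
      (mu3 ×ˢ mu3).image
        (fun p => toR4 (p.1 * (Real.cos θ : ℂ)) (p.2 * (Real.sin θ : ℂ))) := by
    ext x; simp [codeTheta, mu3]
  have hd₁ : Disjoint (mu3.image fun z => toR4 z 0) (mu3.image fun w => toR4 0 w) := by
    rw [Finset.disjoint_left]
    intro x hx hx'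
    simp only [Finset.mem_image] at hx hx'
    obtain ⟨z, hz, rfl⟩ := hx
    obtain ⟨w, hw, e⟩ := hx'
    exact ne_zero_of_mem_mu3 hw (toR4_inj.1 e).2
  have hd₀ : ∀ {a b : ℂ}, a ≠ 0 → b ≠ 0 →
      Disjoint (mu3.image (fun z => toR4 z 0) ∪ mu3.image (fun w => toR4 0 w))
        ((mu3 ×ˢ mu3).image fun p => toR4 (p.1 * a) (p.2 * b)) := by
    intro a b ha hb
    rw [Finset.disjoint_left]
    intro x hx hx'
    simp only [Finset.mem_union, Finset.mem_image, Finset.mem_product] at hx hx'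
    obtain ⟨⟨z, w⟩, ⟨hz, hw⟩, rfl⟩ := hx'
    rcases hx with ⟨z', _, e⟩ | ⟨w', _, e⟩
    · exact mul_ne_zero (ne_zero_of_mem_mu3 hw) hb (toR4_inj.1 e).2.symm
    · exact mul_ne_zero (ne_zero_of_mem_mu3 hz) ha (toR4_inj.1 e).1.symm
  have hd₂ : Disjoint
      ((mu3 ×ˢ mu3).image
        fun p => toR4 (p.1 * (Real.sin θ : ℂ)) (p.2 * (Real.cos θ : ℂ)))
      ((mu3 ×ˢ mu3).image
        fun p => toR4 (p.1 * (Real.cos θ : ℂ)) (p.2 * (Real.sin θ : ℂ))) := by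
    rw [Finset.disjoint_left]
    intro x hx hx'
    simp only [Finset.mem_image, Finset.mem_product] at hx hx'
    obtain ⟨⟨z, w⟩, ⟨hz, hw⟩, rfl⟩ := hx
    obtain ⟨⟨z', w'⟩, ⟨hz', hw'⟩, e⟩ := hx'
    have e₁ := congrArg (· ^ 3) (toR4_inj.1 e).1
    simp only [mul_pow, mem_mu3.1 hz, mem_mu3.1 hz', one_mul] at e₁
    have e₂ : Real.cos θ ^ 3 = Real.sin θ ^ 3 := by exact_mod_cast e₁
    exact h₂ ((Odd.strictMono_pow (by decide : Odd 3)).injective e₂).symm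
  have hinj : ∀ {a b : ℂ}, a ≠ 0 → b ≠ 0 →
      Function.Injective fun p : ℂ × ℂ => toR4 (p.1 * a) (p.2 * b) := by
    rintro a b ha hb ⟨z, w⟩ ⟨z', w'⟩ e
    obtain ⟨e₁, e₂⟩ := toR4_inj.1 e
    exact Prod.ext (mul_right_cancel₀ ha e₁) (mul_right_cancel₀ hb e₂)
  rw [hcode, Finset.sum_union (Finset.disjoint_union_left.2 ⟨hd₀ hc' hs', hd₂⟩),
    Finset.sum_union (hd₀ hs' hc'), Finset.sum_union hd₁,
    Finset.sum_image (hinj hs' hc').injOn, Finset.sum_image (hinj hc' hs').injOn,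
    Finset.sum_image fun z _ z' _ e => (toR4_inj.1 e).1,
    Finset.sum_image fun z _ z' _ e => (toR4_inj.1 e).2, Finset.sum_product, Finset.sum_product]
  simp only [torusSum, Complex.ofReal_one, Complex.ofReal_zero, mul_one, mul_zero,
    Finset.sum_const, nsmul_eq_mul, card_mu3, ← Finset.mul_sum]
  ring

theorem inner_self_of_mem_codeTheta {θ : ℝ} {x : EuclideanSpace ℝ (Fin 4)}
    (hx : x ∈ codeTheta θ) : inner ℝ x x = (1 : ℝ) := by
  have hz : ∀ {z : ℂ}, z ^ 3 = 1 → (z * star z).re = 1 := fun {z} h => by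
    have : ‖z‖ = 1 := Complex.norm_eq_one_of_pow_eq_one h (by norm_num)
    have e : star z = (starRingEnd ℂ) z := rfl
    rw [e, Complex.mul_conj, Complex.normSq_eq_norm_sq, this]
    simp
  obtain ⟨z, w, h₁, h₂, rfl | rfl | rfl | rfl⟩ := (mem_codeTheta θ x).1 hx
  · have := inner_toR4 1 0 1 0 z w z w
    rw [hz h₁] at this
    simpa only [Complex.ofReal_one, Complex.ofReal_zero, mul_one, mul_zero, zero_mul,
      add_zero] using this
  · have := inner_toR4 0 1 0 1 z w z w
    rw [hz h₂] at this
    simpa only [Complex.ofReal_one, Complex.ofReal_zero, mul_one, mul_zero, zero_mul,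
      zero_add] using this
  · rw [inner_toR4, hz h₁, hz h₂]
    linear_combination Real.sin_sq_add_cos_sq θ
  · rw [inner_toR4, hz h₁, hz h₂]
    linear_combination Real.sin_sq_add_cos_sq θ

theorem energy_codeTheta {θ : ℝ} (h : Admissible θ) (f : ℝ → ℝ) :
    energy f (codeTheta θ) = thetaSum f (Real.sin θ) (Real.cos θ) := by
  have hdiag : energy f (codeTheta θ) =
      ∑ x ∈ codeTheta θ, ∑ y ∈ codeTheta θ, f (inner ℝ x y) - ∑ x ∈ codeTheta θ, f 1 := by
    rw [energy, ← Finset.sum_sub_distrib]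
    refine Finset.sum_congr rfl fun x hx => ?_
    rw [Finset.filter_ne', ← Finset.add_sum_erase _ _ hx, inner_self_of_mem_codeTheta hx]
    ring
  have hadd : ∀ (a b : ℝ) (F G : EuclideanSpace ℝ (Fin 4) → ℝ),
      torusSum a b (fun x => F x + G x) = torusSum a b F + torusSum a b G := fun a b F G => by
    simp only [torusSum, Finset.sum_add_distrib]
  have hdiv : ∀ (a b : ℝ) (F : EuclideanSpace ℝ (Fin 4) → ℝ),
      torusSum a b (fun x => F x / 3) = torusSum a b F / 3 := fun a b F => by
    simp only [torusSum, Finset.sum_div]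
  have hconst : ∀ a b t : ℝ, torusSum a b (fun _ => t) = 9 * t := fun a b t => by
    simp only [torusSum, Finset.sum_const, nsmul_eq_mul, card_mu3]
    ring
  rw [hdiag]
  simp only [sum_codeTheta h, hadd, hdiv, torusSum_torusSum, hconst]
  set s := Real.sin θ
  set c := Real.cos θ
  have hsc : s * s + c * c = 1 := by linear_combination Real.sin_sq_add_cos_sq θ
  have hcs : c * c + s * s = 1 := by linear_combination Real.sin_sq_add_cos_sq θ
  rw [hsc, hcs]
  unfold thetaSum
  ring_nf

/-- The value `-1 / 4` avoids both degenerate cases: it gives `sin (2 θ) = -15 / 16`, while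
`sin θ = cos θ` would make `sin (2 θ)` nonnegative. -/
theorem exists_sin_add_cos_eq_neg_quarter :
    ∃ θ : ℝ, Admissible θ ∧ Real.sin θ + Real.cos θ = -1 / 4 := by
  have hcont : Continuous fun θ : ℝ => Real.sin θ + Real.cos θ := by fun_prop
  obtain ⟨θ, -, hθ⟩ := intermediate_value_Icc' Real.pi_pos.le hcont.continuousOn
    (show (-1 / 4 : ℝ) ∈ Set.Icc _ _ by norm_num)
  simp only at hθ
  have h1 := Real.sin_sq_add_cos_sq θ
  have hprod : 2 * Real.sin θ * Real.cos θ = -15 / 16 := by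
    have : (Real.sin θ + Real.cos θ) ^ 2 = (-1 / 4) ^ 2 := by rw [hθ]
    linear_combination this - h1
  refine ⟨θ, ⟨?_, ?_⟩, hθ⟩
  · rw [Real.sin_two_mul, hprod]; norm_num
  · intro h
    rw [h] at hprod
    nlinarith [sq_nonneg (Real.cos θ)]

/-! ### Comparison of the energies -/

theorem mainTheorem2 (k : ℕ) :
    ((∃ θ : ℝ, Admissible θ ∧
        energy (fun t : ℝ => (1 + t) ^ k) (codeTheta θ) <
          energy (fun t : ℝ => (1 + t) ^ k) codeD4) ↔ 8 ≤ k ∧ k ≤ 13) ∧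
    (¬ (8 ≤ k ∧ k ≤ 13) → ∀ θ : ℝ, Admissible θ →
        energy (fun t : ℝ => (1 + t) ^ k) codeD4 ≤
          energy (fun t : ℝ => (1 + t) ^ k) (codeTheta θ)) := by
  have h4 : (0 : ℝ) < 4 ^ k := by positivity
  have hθ : ∀ θ : ℝ, Admissible θ → 4 ^ k * energy (fun t : ℝ => (1 + t) ^ k) (codeTheta θ) =
      evalL (thetaL k) (Real.sin θ + Real.cos θ) := fun θ h => by
    rw [energy_codeTheta h, evalL_thetaL (Real.sin_sq_add_cos_sq θ)]
  have hge : ¬ (8 ≤ k ∧ k ≤ 13) → ∀ θ : ℝ, Admissible θ →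
      energy (fun t : ℝ => (1 + t) ^ k) codeD4 ≤
        energy (fun t : ℝ => (1 + t) ^ k) (codeTheta θ) := fun hk θ h => by
    refine le_of_mul_le_mul_left ?_ h4
    rw [hθ θ h, four_pow_mul_energy_codeD4]
    exact d4Z_le_thetaL (Real.sin_sq_add_cos_sq θ) hk
  refine ⟨⟨?_, ?_⟩, hge⟩
  · rintro ⟨θ, h, hlt⟩
    by_contra hk
    exact (hge hk θ h).not_gt hlt
  · rintro ⟨h₁, h₂⟩
    obtain ⟨θ, h, hp⟩ := exists_sin_add_cos_eq_neg_quarter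
    refine ⟨θ, h, lt_of_mul_lt_mul_left ?_ h4.le⟩
    rw [hθ θ h, four_pow_mul_energy_codeD4, hp]
    have := evalL_diffL_neg h₁ h₂
    simp only [diffL, evalL_addL, evalL] at this
    push_cast at this
    linarith
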